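/- Let $\mathbb{F}_q$ be the finite field with $q$ elements, of characteristic $p$, and let $H$ be a finite non-abelian group with $p\nmid |H|$. Let $H'$ be the commutator subgroup of $H$, let $G=H/H'$, let $w\in G$ be an element whose order equals the exponent of $G$, and let $t_w=\min\{a\in\mathbb{Z}_{>0}: w^{q^a}=w\}$. Modules and ideals are left modules and left ideals. *Definitions.* An idempotent is primitive if it is non-zero and is not the sum of two non-zero orthogonal idempotents. $\mathbb{F}_qH$ is *minimal ECD* if it is semisimple and every left ideal generated by a primitive idempotent has $\mathbb{F}_q$-dimension at most $p$. $\mathbb{F}_q$ is a *splitting field* for $H$ if $\mathrm{End}_{\mathbb{F}_qH}(S)=\mathbb{F}_q$ for every simple $\mathbb{F}_qH$-module $S$. An $\mathbb{F}_qH$-module $M$ is *absolutely simple* if $E\otimes_{\mathbb{F}_q}M$ is a simple $E\otimes_{\mathbb{F}_q}\mathbb{F}_qH$-module for every extension field $E$ of $\mathbb{F}_q$. The algebra $\mathbb{F}_qH$ has a Wedderburn–Artin decomposition $$\mathbb{F}_qH\;\cong\;\Big(\bigoplus_{i=1}^{r}E_i\Big)\oplus\Big(\bigoplus_{j=1}^{s}M_{n_j}(F_j)\Big)$$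 as $\mathbb{F}_q$-algebras, where the $E_i$ and $F_j$ are extension fields of $\mathbb{F}_q$ and $n_j\ge 2$ for all $j$. In every such decomposition $s\geq 1$; let $B_j\subseteq\mathbb{F}_qH$ be the simple component corresponding to $M_{n_j}(F_j)$. Put $$\gamma=|H|-|H/H'|,\qquad b_0=\max_{1\le f\le\lfloor\gamma/4\rfloor}\Big\lfloor\sqrt{\gamma/f}\Big\rfloor\cdot f .$$ Then: 1. For every such decomposition, $\max_{1\le j\le s} n_j[F_j:\mathbb{F}_q]\le b_0$; moreover $b_0\le\lfloor\gamma/2\rfloor$. 2. If $t_w\le p$, and $b_0\le p$ or $\lfloor\gamma/2\rfloor\le p$, then $\mathbb{F}_qH$ is minimal ECD. 3. If for every $j\in\{1,\dots,s\}$ a minimal left ideal $I_j$ of $\mathbb{F}_qH$ contained in $B_j$ is absolutely simple, then $$\Big\lceil\sqrt{\gamma/s}\,\Big\rceil\le\max_{1\le j\le s} n_j\le\lfloor\sqrt{\gamma}\rfloor ;$$ if in this case also $\lfloor\sqrt{\gamma}\rfloor\le p$ and $t_w\le p$, then $\mathbb{F}_qH$ is minimal ECD. Moreover, if $\mathbb{F}_q$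 is a splitting field for $H$ and $\lfloor\sqrt{\gamma}\rfloor\le p$, then $\mathbb{F}_qH$ is minimal ECD. -/

import Mathlib

open scoped TensorProduct

universe u v w x

namespace GroupCode

noncomputable section

/-- The size of the `q`-orbit of `g`: the least `a > 0` with `g ^ (q ^ a) = g`. -/
def qOrbitSize {G : Type v} [Group G] (q : ℕ) (g : G) : ℕ :=
  sInf {a : ℕ | 0 < a ∧ g ^ (q ^ a) = g}

/-- A primitive idempotent: a nonzero idempotent which is not a sum of two nonzero
orthogonal idempotents. -/
def IsPrimitiveIdempotent {A : Type v} [Ring A] (e : A) : Prop :=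
  IsIdempotentElem e ∧ e ≠ 0 ∧
    ∀ f g : A, IsIdempotentElem f → IsIdempotentElem g → f * g = 0 → g * f = 0 → f + g = e →
      f = 0 ∨ g = 0

section GroupAlgebra

variable (F : Type u) [Field F] (H : Type v) [Group H]

/-- A (left) group code of easily computable dimension: a left ideal of the group algebra that is
generated by an idempotent and whose dimension is at most the characteristic. -/
def IsECD (C : Ideal (MonoidAlgebra F H)) : Prop :=
  (∃ e : MonoidAlgebra F H, IsIdempotentElem e ∧ C = Ideal.span {e}) ∧
    Module.finrank F C ≤ ringChar F

/-- All principal indecomposable modules (left ideals generated by a primitive idempotent) of the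
group algebra are ECD. -/
def IsECID : Prop :=
  ∀ e : MonoidAlgebra F H, IsPrimitiveIdempotent e → IsECD F H (Ideal.span {e})

/-- A minimal ECD group algebra is a semisimple ECID group algebra. -/
def IsMinimalECD : Prop :=
  IsSemisimpleRing (MonoidAlgebra F H) ∧ IsECID F H

/-- `F` is a splitting field for `H`: `End_{FH}(S) = F` for every simple `FH`-module `S`. -/
def IsSplittingFieldFor : Prop :=
  ∀ (S : Type (max u v)) [AddCommGroup S] [Module F S] [Module (MonoidAlgebra F H) S]
    [IsScalarTower F (MonoidAlgebra F H) S] [IsSimpleModule (MonoidAlgebra F H) S],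
    Function.Bijective (algebraMap F (Module.End (MonoidAlgebra F H) S))

end GroupAlgebra

section AbsolutelySimple

variable (k : Type u) [Field k] (A : Type v) [Ring A] [Algebra k A]
  (M : Type w) [AddCommGroup M] [Module k M] [Module A M] [IsScalarTower k A M]

/-- The action of `E ⊗ A` on `E ⊗ M`, `(c ⊗ a) • (d ⊗ m) = (c d) ⊗ (a m)`. -/
def baseChangeAction (E : Type x) [Field E] [Algebra k E] :
    (E ⊗[k] A) →ₐ[k] Module.End k (E ⊗[k] M) :=
  (Module.endTensorEndAlgHom (R := k) (S := k) (A := k) (M := E) (N := M)).comp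
    (Algebra.TensorProduct.map (Algebra.lsmul k k E) (Algebra.lsmul k k M))

theorem baseChangeAction_tmul (E : Type x) [Field E] [Algebra k E] (c d : E) (a : A) (m : M) :
    baseChangeAction k A M E (c ⊗ₜ a) (d ⊗ₜ m) = (c * d) ⊗ₜ (a • m) := by
  simp [baseChangeAction, Module.endTensorEndAlgHom_apply]

/-- The `E ⊗ A`-module `E ⊗ M`. -/
abbrev baseChangeModule (E : Type x) [Field E] [Algebra k E] : Module (E ⊗[k] A) (E ⊗[k] M) :=
  Module.compHom (E ⊗[k] M) (baseChangeAction k A M E).toRingHom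

/-- `M` is absolutely simple: `E ⊗ M` is a simple `E ⊗ A`-module for all extension fields `E`
of `k`. -/
def IsAbsolutelySimple : Prop :=
  ∀ (E : Type u) [Field E] [Algebra k E],
    letI : Module (E ⊗[k] A) (E ⊗[k] M) := baseChangeModule k A M E
    IsSimpleModule (E ⊗[k] A) (E ⊗[k] M)

end AbsolutelySimple

/-- A Wedderburn–Artin decomposition of an algebra `A` over the field `F` into
`r` commutative simple components, isomorphic to the extension fields `E i` of `F`, and
`s` noncommutative simple components, isomorphic to the matrix algebras `M_{n j}(K j)` with
`n j ≥ 2` and `K j` an extension field of `F`. -/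
structure WedderburnDecomposition (F : Type u) [Field F] (A : Type v) [Ring A] [Algebra F A] where
  r : ℕ
  s : ℕ
  E : Fin r → Type w
  K : Fin s → Type w
  n : Fin s → ℕ
  [fieldE : ∀ i, Field (E i)]
  [algebraE : ∀ i, Algebra F (E i)]
  [fieldK : ∀ j, Field (K j)]
  [algebraK : ∀ j, Algebra F (K j)]
  two_le_n : ∀ j, 2 ≤ n j
  equiv : A ≃ₐ[F] (∀ i, E i) × (∀ j, Matrix (Fin (n j)) (Fin (n j)) (K j))

attribute [instance] WedderburnDecomposition.fieldE WedderburnDecomposition.algebraE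
  WedderburnDecomposition.fieldK WedderburnDecomposition.algebraK

namespace WedderburnDecomposition

variable {F : Type u} [Field F] {A : Type v} [Ring A] [Algebra F A]
  (D : WedderburnDecomposition.{u, v, w} F A)

/-- The noncommutative simple component `B j` of `A`, the ideal of all elements whose coordinates
outside the factor `M_{n j}(K j)` vanish. -/
def component (j : Fin D.s) : Ideal A where
  carrier := {a | (D.equiv a).1 = 0 ∧ ∀ l, l ≠ j → (D.equiv a).2 l = 0}
  zero_mem' := by simp
  add_mem' := by
    rintro a b ⟨ha, ha'⟩ ⟨hb, hb'⟩
    refine ⟨by simp [ha, hb], fun l hl => by simp [ha' l hl, hb' l hl]⟩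
  smul_mem' := by
    rintro c a ⟨ha, ha'⟩
    refine ⟨by simp [ha], fun l hl => by simp [ha' l hl]⟩

/-- The maximum of the numbers `n j * [K j : F]`. -/
def maxDim : ℕ := Finset.univ.sup fun j => D.n j * Module.finrank F (D.K j)

/-- The maximum of the matrix sizes `n j`. -/
def maxSize : ℕ := Finset.univ.sup D.n

end WedderburnDecomposition

/-- `γ = |H| - |H / H'|`, where `H'` is the commutator subgroup. -/
def gam (H : Type v) [Group H] : ℕ := Nat.card H - Nat.card (Abelianization H)

/-- The maximum of `⌊√(c / f)⌋ * f` over `1 ≤ f ≤ ⌊c / 4⌋`. -/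
def bZero (c : ℕ) : ℕ :=
  (Finset.Icc 1 (c / 4)).sup fun f => ⌊Real.sqrt ((c : ℝ) / (f : ℝ))⌋₊ * f

end

end GroupCode

/-! Everything rests on a dimension count. Matrix blocks of size at least 2 die in every commutative
algebra (`map_inclMatrix_eq_zero`), and homomorphisms from `FH` to commutative algebras factor
through `H / H'`. So the field part of `FH` has the dimension of `F[H / H']`, leaving `∑ n_j² [F_j :
F] = γ` (`sum_finrank_matrices`). Each block then satisfies `n² f ≤ γ` with `n ≥ 2`, which yields `n
f ≤ b₀ ≤ γ / 2`.

A primitive idempotent lies in one block and has rank one there, so its left ideal has dimension at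
most `[E_i : F]` or `n_j [F_j : F]` (`finrank_span_le_of_isPrimitiveIdempotent`). It remains to
bound these by `p`. Since `E_i` is spanned by the image of `H / H'`, a power of Frobenius fixing
that image is trivial, whence `[E_i : F] ≤ t_w`. Under absolute simplicity or splitting, the centre
of a block acts on a simple module by elements of `F`, which forces `F_j = F` and reduces the count
to `∑ n_j² = γ`. -/

namespace GroupCode

/-! ### Numerical bounds on `b₀` and square roots -/

section Numeric

theorem bZero_le_half (c : ℕ) : bZero c ≤ c / 2 := by
  refine Finset.sup_le fun f hf => ?_
  obtain ⟨h1, h2⟩ := Finset.mem_Icc.mp hf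
  have h4 : 4 * f ≤ c := by omega
  have hf0 : (0 : ℝ) < f := by exact_mod_cast h1
  rw [Nat.le_div_iff_mul_le two_pos]
  have h4' : (4 : ℝ) * f ≤ c := by exact_mod_cast h4
  set k := ⌊Real.sqrt ((c : ℝ) / (f : ℝ))⌋₊
  have hk : (k : ℝ) ≤ Real.sqrt ((c : ℝ) / (f : ℝ)) := Nat.floor_le (Real.sqrt_nonneg _)
  have hk2 : (k : ℝ) ^ 2 * f ≤ c := by
    rw [← le_div_iff₀ hf0]
    exact (Real.le_sqrt (by positivity) (by positivity)).mp hk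
  have : ((k * f * 2 : ℕ) : ℝ) ^ 2 ≤ (c : ℝ) ^ 2 := by
    push_cast
    calc ((k : ℝ) * f * 2) ^ 2 = ((k : ℝ) ^ 2 * f) * (4 * f) := by ring
      _ ≤ (c : ℝ) * c := by gcongr
      _ = (c : ℝ) ^ 2 := by ring
  exact_mod_cast (pow_le_pow_iff_left₀ (by positivity) (by positivity) two_ne_zero).mp this

/-- The hypothesis `n ≥ 2` is what puts `f` in the range `f ≤ c / 4` of the maximum. -/
theorem mul_le_bZero {c n f : ℕ} (hn : 2 ≤ n) (h : n * n * f ≤ c) : n * f ≤ bZero c := by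
  rcases Nat.eq_zero_or_pos f with rfl | hf
  · simp
  have h4 : 4 * f ≤ c := le_trans (Nat.mul_le_mul_right _ (by nlinarith)) h
  have hf0 : (0 : ℝ) < f := by exact_mod_cast hf
  have hle : n ≤ ⌊Real.sqrt ((c : ℝ) / (f : ℝ))⌋₊ := by
    refine Nat.le_floor (Real.le_sqrt_of_sq_le ?_)
    rw [le_div_iff₀ hf0, sq]
    exact_mod_cast h
  exact (Nat.mul_le_mul_right f hle).trans
    (Finset.le_sup (f := fun f : ℕ => ⌊Real.sqrt ((c : ℝ) / (f : ℝ))⌋₊ * f)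
      (Finset.mem_Icc.mpr ⟨hf, by omega⟩))

theorem le_floor_sqrt {c n : ℕ} (h : n * n ≤ c) : n ≤ ⌊Real.sqrt (c : ℝ)⌋₊ := by
  refine Nat.le_floor (Real.le_sqrt_of_sq_le ?_)
  rw [sq]
  exact_mod_cast h

theorem ceil_sqrt_div_le {c s n : ℕ} (hs : 0 < s) (h : c ≤ s * (n * n)) :
    ⌈Real.sqrt ((c : ℝ) / (s : ℝ))⌉₊ ≤ n := by
  refine Nat.ceil_le.mpr (Real.sqrt_le_iff.mpr ⟨by positivity, ?_⟩)
  rw [div_le_iff₀ (by exact_mod_cast hs), sq, mul_comm]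
  exact_mod_cast h

end Numeric

/-! ### Primitive idempotents -/

section Idempotent

/-- Here `e = f + (e - f)` is an orthogonal decomposition, so primitivity kills `e - f`. -/
theorem IsPrimitiveIdempotent.eq_of_mul_eq {A : Type v} [Ring A] {e f : A}
    (he : IsPrimitiveIdempotent e) (hf : IsIdempotentElem f) (hef : e * f = f) (hfe : f * e = f)
    (hf0 : f ≠ 0) : e = f := by
  have h := he.2.2 f (e - f) hf
    (by simp only [IsIdempotentElem, sub_mul, mul_sub, he.1.eq, hf.eq, hef, hfe]; simp)
    (by rw [mul_sub, hfe, hf.eq, sub_self]) (by rw [sub_mul, hef, hf.eq, sub_self])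
    (add_sub_cancel _ _)
  exact sub_eq_zero.mp (h.resolve_left hf0)

theorem finrank_span_le {F : Type u} [Field F] {A : Type v} [Ring A] [Algebra F A]
    [Module.Finite F A] {V : Type w} [AddCommGroup V] [Module F V] [Module.Finite F V]
    (φ : V →ₗ[F] A) {e : A} (h : ∀ a, a * e ∈ LinearMap.range φ) :
    Module.finrank F (Ideal.span {e} : Ideal A) ≤ Module.finrank F V := by
  have hle : (Ideal.span {e} : Ideal A).restrictScalars F ≤ LinearMap.range φ := by
    intro x hx
    obtain ⟨a, rfl⟩ := Ideal.mem_span_singleton'.mp hx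
    exact h a
  exact (Submodule.finrank_mono hle).trans (LinearMap.finrank_range_le φ)

end Idempotent

/-! ### Absolutely simple ideals and the centre of a block -/

section Scalars

variable {F : Type u} [Field F] {A : Type v} [Ring A] [Algebra F A]
  {L : Type w} [Field L] [Algebra F L] {ι : L →ₗ[F] A}

/-- A nonzero `α - a` would be invertible in `L` and yet kill `m`. The map `ι` need not be unital:
`ι 1` is the idempotent of a block, hence the separate hypothesis `h1`. -/
theorem eq_algebraMap_of_smul_eq {S : Type x} [AddCommGroup S] [Module F S] [Module A S]
    [IsScalarTower F A S] (hmul : ∀ α β, ι (α * β) = ι α * ι β) {m : S} (hm : m ≠ 0)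
    (h1 : ι 1 • m = m) {α : L} {a : F} (h : ι α • m = a • m) : algebraMap F L a = α := by
  by_contra hne
  have hβ : α - algebraMap F L a ≠ 0 := sub_ne_zero.mpr (Ne.symm hne)
  have h0 : ι (α - algebraMap F L a) • m = 0 := by
    rw [Algebra.algebraMap_eq_smul_one, map_sub, map_smul, sub_smul, h, smul_assoc, h1, sub_self]
  apply hm
  rw [← h1, ← inv_mul_cancel₀ hβ, hmul, mul_smul, h0, smul_zero]

theorem finrank_eq_one_of_surjective (h : Function.Surjective (algebraMap F L)) :
    Module.finrank F L = 1 := by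
  have e := LinearEquiv.ofBijective (Algebra.linearMap F L) ⟨(algebraMap F L).injective, h⟩
  rw [← e.finrank_eq, Module.finrank_self]

/-- Schur's lemma over the algebraic closure `Ω`: the central element `ι α` has an eigenvalue `c` on
`Ω ⊗ I`, and by simplicity it acts as `c` everywhere. A functional `Ω → F` then brings the scalar
down to `F`. -/
theorem algebraMap_surjective_of_isAbsolutelySimple [Module.Finite F A]
    (hmul : ∀ α β, ι (α * β) = ι α * ι β) (hcomm : ∀ α a, ι α * a = a * ι α)
    (I : Ideal A) (hI : ∀ m ∈ I, ι 1 * m = m) (hs : IsAbsolutelySimple F A I) :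
    Function.Surjective (algebraMap F L) := by
  intro α
  have : Module.Finite F I := inferInstanceAs (Module.Finite F (I.restrictScalars F))
  let Ω := AlgebraicClosure F
  let mod : Module (Ω ⊗[F] A) (Ω ⊗[F] I) := baseChangeModule F A I Ω
  have hsimple : IsSimpleModule (Ω ⊗[F] A) (Ω ⊗[F] I) := hs Ω
  have hsmul : ∀ (c d : Ω) (a : A) (m : I),
      (c ⊗ₜ[F] a : Ω ⊗[F] A) • (d ⊗ₜ[F] m : Ω ⊗[F] I) = (c * d) ⊗ₜ[F] (a • m) :=
    fun c d a m => baseChangeAction_tmul F A I Ω c d a m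
  have hnt : Nontrivial (Ω ⊗[F] I) := IsSimpleModule.nontrivial (Ω ⊗[F] A) _
  let T : Module.End Ω (Ω ⊗[F] I) :=
    (Algebra.lsmul F F I (ι α)).baseChange Ω
  have hT : ∀ (d : Ω) (m : I), T (d ⊗ₜ[F] m) = d ⊗ₜ[F] (ι α • m) := fun d m => rfl
  obtain ⟨c, hc⟩ := Module.End.exists_eigenvalue T
  have hTlin : ∀ (b : Ω ⊗[F] A) (y : Ω ⊗[F] I), T (b • y) = b • T y := by
    intro b y
    induction b with
    | zero => simp
    | add b₁ b₂ h₁ h₂ => simp only [add_smul, map_add, h₁, h₂]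
    | tmul d a =>
      induction y with
      | zero => simp
      | add y₁ y₂ h₁ h₂ => simp only [smul_add, map_add, h₁, h₂]
      | tmul d' m => rw [hsmul, hT, hT, hsmul, smul_smul, smul_smul, hcomm]
  have hclin : ∀ (b : Ω ⊗[F] A) (y : Ω ⊗[F] I), c • (b • y) = b • (c • y) := by
    intro b y
    induction b with
    | zero => simp
    | add b₁ b₂ h₁ h₂ => simp only [add_smul, smul_add, h₁, h₂]
    | tmul d a =>
      induction y with
      | zero => simp
      | add y₁ y₂ h₁ h₂ => simp only [smul_add, h₁, h₂]
      | tmul d' m =>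
        rw [hsmul, TensorProduct.smul_tmul', TensorProduct.smul_tmul', hsmul, smul_eq_mul,
          smul_eq_mul, mul_left_comm]
  -- The eigenspace is an `Ω ⊗ A`-submodule because both `T` and `c` commute with the action.
  let N : Submodule (Ω ⊗[F] A) (Ω ⊗[F] I) :=
    { carrier := {y | T y = c • y}
      zero_mem' := by simp
      add_mem' := by
        intro y z hy hz
        change T (y + z) = c • (y + z)
        rw [map_add, show T y = _ from hy, show T z = _ from hz, smul_add]
      smul_mem' := by
        intro b y hy
        change T (b • y) = c • b • y
        rw [hTlin, show T y = _ from hy, hclin] }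
  obtain ⟨y, hy⟩ := hc.exists_hasEigenvector
  have hN : N = ⊤ := by
    refine (eq_bot_or_eq_top N).resolve_left fun h => hy.2 ?_
    have : y ∈ N := Module.End.mem_eigenspace_iff.mp hy.1
    rwa [h, Submodule.mem_bot] at this
  have hI0 : Nontrivial I := by
    by_contra h
    rw [not_nontrivial_iff_subsingleton] at h
    exact not_subsingleton (Ω ⊗[F] I) inferInstance
  obtain ⟨m, hm⟩ := exists_ne (0 : I)
  have hTm : (1 : Ω) ⊗ₜ[F] (ι α • m) = c ⊗ₜ[F] m := by
    have : (1 : Ω) ⊗ₜ[F] m ∈ N := hN ▸ Submodule.mem_top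
    have h : T ((1 : Ω) ⊗ₜ[F] m) = c • ((1 : Ω) ⊗ₜ[F] m) := this
    rwa [hT, TensorProduct.smul_tmul', smul_eq_mul, mul_one] at h
  -- Apply `f ⊗ id` to `1 ⊗ αm = c ⊗ m`; choosing `f 1 = 1` shows that `α` acts as `f c`.
  have key : ∀ f : Module.Dual F Ω, f 1 • (ι α • m) = f c • m := by
    intro f
    have := congrArg (TensorProduct.lid F I ∘ f.rTensor I) hTm
    simpa using this
  obtain ⟨f, hf⟩ := Module.Projective.exists_dual_eq_one F (one_ne_zero : (1 : Ω) ≠ 0)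
  refine ⟨f c, eq_algebraMap_of_smul_eq hmul hm ?_ (a := f c) ?_⟩
  · exact Subtype.ext (hI m m.2)
  · simpa [hf] using key f

end Scalars

/-! ### Splitting fields -/

section Splitting

variable {F : Type u} [Field F] {H : Type v} [Group H]
  {L : Type w} [Field L] [Algebra F L] {ι : L →ₗ[F] MonoidAlgebra F H}

/-- On a minimal left ideal inside the one generated by the central idempotent `ι 1`, the central
element `ι α` acts as a module endomorphism, hence as an element of `F`. -/
theorem algebraMap_surjective_of_isSplittingFieldFor [IsSemisimpleRing (MonoidAlgebra F H)]
    (hmul : ∀ α β, ι (α * β) = ι α * ι β) (hcomm : ∀ α a, ι α * a = a * ι α) (h1 : ι 1 ≠ 0)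
    (hs : IsSplittingFieldFor F H) : Function.Surjective (algebraMap F L) := by
  intro α
  obtain ⟨S, hS, hle⟩ := (eq_bot_or_exists_atom_le (Ideal.span {ι 1})).resolve_left
    (by simpa using h1)
  have hSs : IsSimpleModule (MonoidAlgebra F H) S := isSimpleModule_iff_isAtom.mpr hS
  have hid : ∀ m : S, ι 1 • m = m := by
    rintro ⟨m, hm⟩
    obtain ⟨a, rfl⟩ := Ideal.mem_span_singleton'.mp (hle hm)
    refine Subtype.ext ?_
    change ι 1 * (a * ι 1) = a * ι 1
    rw [hcomm, mul_assoc, ← hmul, one_mul]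
  let T : Module.End (MonoidAlgebra F H) S :=
    { toFun := fun m => ι α • m
      map_add' := fun m m' => smul_add _ _ _
      map_smul' := fun a m => by
        rw [RingHom.id_apply, smul_smul, smul_smul, hcomm] }
  obtain ⟨a, ha⟩ := (hs S).2 T
  have : Nontrivial S := IsSimpleModule.nontrivial (MonoidAlgebra F H) S
  obtain ⟨m, hm⟩ := exists_ne (0 : S)
  refine ⟨a, eq_algebraMap_of_smul_eq hmul hm (hid m) (a := a) ?_⟩
  have := LinearMap.congr_fun ha m
  rw [Module.algebraMap_end_apply] at this
  exact this.symm

end Splitting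

/-! ### The group algebra of the abelianization -/

section Abelianization

theorem finrank_monoidAlgebra (F : Type u) [Field F] (H : Type v) :
    Module.finrank F (MonoidAlgebra F H) = Nat.card H :=
  Module.finrank_eq_nat_card_basis (MonoidAlgebra.basis H F)

variable (F : Type u) [Field F] (H : Type v) [Group H]

/-- The projection of the group algebra of `H` onto that of its abelianization. -/
noncomputable def abelianizationAlgHom :
    MonoidAlgebra F H →ₐ[F] MonoidAlgebra F (Abelianization H) :=
  MonoidAlgebra.lift F _ H ((MonoidAlgebra.of F (Abelianization H)).comp Abelianization.of)

theorem abelianizationAlgHom_of (h : H) :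
    abelianizationAlgHom F H (MonoidAlgebra.of F H h) =
      MonoidAlgebra.of F _ (Abelianization.of h) :=
  MonoidAlgebra.lift_of _ _

theorem abelianizationAlgHom_surjective : Function.Surjective (abelianizationAlgHom F H) := by
  intro y
  change y ∈ (abelianizationAlgHom F H).range
  induction y using MonoidAlgebra.induction_on with
  | of g =>
    obtain ⟨h, rfl⟩ := QuotientGroup.mk_surjective g
    exact ⟨_, abelianizationAlgHom_of F H h⟩
  | add x y hx hy => exact add_mem hx hy
  | smul r x hx => exact Subalgebra.smul_mem _ hx r

variable {F H}

/-- The homomorphism on the group algebra of the abelianization induced by a homomorphism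
to a commutative algebra. -/
noncomputable def liftAbelianization {C : Type w} [CommRing C] [Algebra F C]
    (χ : MonoidAlgebra F H →ₐ[F] C) : MonoidAlgebra F (Abelianization H) →ₐ[F] C :=
  MonoidAlgebra.lift F C _ ((Units.coeHom C).comp (Abelianization.lift
    (MonoidHom.toHomUnits ((χ : MonoidAlgebra F H →* C).comp (MonoidAlgebra.of F H)))))

theorem liftAbelianization_comp {C : Type w} [CommRing C] [Algebra F C]
    (χ : MonoidAlgebra F H →ₐ[F] C) :
    (liftAbelianization χ).comp (abelianizationAlgHom F H) = χ := by
  refine MonoidAlgebra.algHom_ext (fun h => ?_) (Subsingleton.elim _ _)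
  change liftAbelianization χ (abelianizationAlgHom F H (MonoidAlgebra.of F H h)) = _
  rw [abelianizationAlgHom_of, liftAbelianization, MonoidAlgebra.lift_of]
  rfl

theorem liftAbelianization_surjective {C : Type w} [CommRing C] [Algebra F C]
    {χ : MonoidAlgebra F H →ₐ[F] C} (hχ : Function.Surjective χ) :
    Function.Surjective (liftAbelianization χ) := by
  rw [← liftAbelianization_comp χ, AlgHom.coe_comp] at hχ
  exact hχ.of_comp

end Abelianization

/-! ### Orbit sizes and degrees of the commutative components -/

section Orbit

theorem pow_eq_self_of_orderOf_eq_exponent {G : Type v} [Group G] {w : G}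
    (hw : orderOf w = Monoid.exponent G) {k : ℕ} (h : w ^ k = w) (g : G) : g ^ k = g := by
  -- The exponent `k - 1` is taken in `ℤ`, so `k = 0` needs no separate case.
  have h1 : w ^ ((k : ℤ) - 1) = 1 := by rw [zpow_sub_one, zpow_natCast, h, mul_inv_cancel]
  have h2 : g ^ ((k : ℤ) - 1) = 1 := by
    rw [← orderOf_dvd_iff_zpow_eq_one] at h1 ⊢
    exact (Int.natCast_dvd_natCast.mpr (hw ▸ Monoid.order_dvd_exponent g)).trans h1
  rwa [zpow_sub_one, zpow_natCast, mul_inv_eq_one] at h2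

/-- Euler's theorem modulo the order of `g` makes the defining set nonempty, so the infimum is
attained and is not the default value 0. -/
theorem qOrbitSize_spec {G : Type v} [Group G] [Finite G] {q : ℕ} (hq : q.Coprime (Nat.card G))
    (g : G) : 0 < qOrbitSize q g ∧ g ^ (q ^ qOrbitSize q g) = g := by
  refine Nat.sInf_mem (s := {a : ℕ | 0 < a ∧ g ^ (q ^ a) = g})
    ⟨(orderOf g).totient, Nat.totient_pos.mpr (orderOf_pos g), ?_⟩
  conv_rhs => rw [← pow_one g]
  rw [pow_eq_pow_iff_modEq]
  exact Nat.ModEq.pow_totient (hq.coprime_dvd_right (orderOf_dvd_natCard g))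

/-- The image of `H / H'` spans `E` and is fixed by the `t`-th power of Frobenius, whose order is
`[E : F]`. -/
theorem finrank_le_of_pow_eq {F : Type u} [Field F] [Finite F] {H : Type v} [Group H]
    {E : Type w} [Field E] [Algebra F E] [Module.Finite F E]
    {χ : MonoidAlgebra F H →ₐ[F] E} (hχ : Function.Surjective χ) {t : ℕ} (ht : 0 < t)
    (h : ∀ g : Abelianization H, g ^ (Nat.card F ^ t) = g) : Module.finrank F E ≤ t := by
  have : Fintype F := Fintype.ofFinite F
  have : Finite E := Module.finite_of_finite F
  have hsurj := liftAbelianization_surjective hχ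
  set χ' := liftAbelianization χ
  have h1 : (FiniteField.frobeniusAlgHom F E ^ t).comp χ' = χ' := by
    refine MonoidAlgebra.algHom_ext (fun g => ?_) (Subsingleton.elim _ _)
    change (FiniteField.frobeniusAlgHom F E ^ t) (χ' (MonoidAlgebra.of F _ g)) =
      χ' (MonoidAlgebra.of F _ g)
    rw [AlgHom.coe_pow, FiniteField.coe_frobeniusAlgHom, pow_iterate, ← Nat.card_eq_fintype_card]
    change χ' _ ^ (Nat.card F ^ t) = _
    rw [← map_pow, ← map_pow, h]
  have h2 : FiniteField.frobeniusAlgHom F E ^ t = 1 := by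
    ext y
    obtain ⟨z, rfl⟩ := hsurj y
    exact DFunLike.congr_fun h1 z
  rw [← FiniteField.orderOf_frobeniusAlgHom F E]
  exact orderOf_le_of_pow_eq_one ht h2

end Orbit

/-! ### Blocks of a Wedderburn decomposition -/

namespace WedderburnDecomposition

section Basic

variable {F : Type u} [Field F] {A : Type v} [Ring A] [Algebra F A]
  (D : WedderburnDecomposition.{u, v, w} F A)

/-- The embedding of the field `E i` in `A`. -/
noncomputable def inclField (i : Fin D.r) : D.E i →ₗ[F] A :=
  D.equiv.symm.toLinearMap ∘ₗ LinearMap.inl F _ _ ∘ₗ LinearMap.single F D.E i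

/-- The embedding of the matrix algebra `M_{n j}(K j)` in `A`. -/
noncomputable def inclMatrix (j : Fin D.s) : Matrix (Fin (D.n j)) (Fin (D.n j)) (D.K j) →ₗ[F] A :=
  D.equiv.symm.toLinearMap ∘ₗ LinearMap.inr F _ _ ∘ₗ
    LinearMap.single F (fun j => Matrix (Fin (D.n j)) (Fin (D.n j)) (D.K j)) j

/-- The embedding of `K j` in `A` as the centre of a matrix component. -/
noncomputable def inclScalar (j : Fin D.s) : D.K j →ₗ[F] A :=
  D.inclMatrix j ∘ₗ (Matrix.scalarAlgHom (Fin (D.n j)) F).toLinearMap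

theorem equiv_inclField (i : Fin D.r) (x : D.E i) :
    D.equiv (D.inclField i x) = (Pi.single i x, 0) := by
  simp [inclField]

theorem equiv_inclMatrix (j : Fin D.s) (y : Matrix (Fin (D.n j)) (Fin (D.n j)) (D.K j)) :
    D.equiv (D.inclMatrix j y) = (0, Pi.single j y) := by
  simp [inclMatrix]

theorem inclScalar_apply (j : Fin D.s) (α : D.K j) :
    D.inclScalar j α = D.inclMatrix j (Matrix.scalar _ α) := rfl

theorem mul_inclField (i : Fin D.r) (a : A) (x : D.E i) :
    a * D.inclField i x = D.inclField i ((D.equiv a).1 i * x) := by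
  apply D.equiv.injective
  rw [map_mul, equiv_inclField, equiv_inclField, Prod.ext_iff]
  exact ⟨(Pi.single_mul_right (f := (D.equiv a).1) _).symm, mul_zero _⟩

theorem inclField_mul (i : Fin D.r) (a : A) (x : D.E i) :
    D.inclField i x * a = D.inclField i (x * (D.equiv a).1 i) := by
  apply D.equiv.injective
  rw [map_mul, equiv_inclField, equiv_inclField, Prod.ext_iff]
  exact ⟨(Pi.single_mul_left (f := (D.equiv a).1) _).symm, zero_mul _⟩

theorem mul_inclMatrix (j : Fin D.s) (a : A) (y : Matrix (Fin (D.n j)) (Fin (D.n j)) (D.K j)) :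
    a * D.inclMatrix j y = D.inclMatrix j ((D.equiv a).2 j * y) := by
  apply D.equiv.injective
  rw [map_mul, equiv_inclMatrix, equiv_inclMatrix, Prod.ext_iff]
  exact ⟨mul_zero _, (Pi.single_mul_right (f := (D.equiv a).2) _).symm⟩

theorem inclMatrix_mul (j : Fin D.s) (a : A) (y : Matrix (Fin (D.n j)) (Fin (D.n j)) (D.K j)) :
    D.inclMatrix j y * a = D.inclMatrix j (y * (D.equiv a).2 j) := by
  apply D.equiv.injective
  rw [map_mul, equiv_inclMatrix, equiv_inclMatrix, Prod.ext_iff]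
  exact ⟨zero_mul _, (Pi.single_mul_left (f := (D.equiv a).2) _).symm⟩

theorem inclField_mul_inclField (i : Fin D.r) (α β : D.E i) :
    D.inclField i α * D.inclField i β = D.inclField i (α * β) := by
  rw [mul_inclField, equiv_inclField]
  simp only [Pi.single_eq_same]

theorem inclMatrix_mul_inclMatrix (j : Fin D.s)
    (y z : Matrix (Fin (D.n j)) (Fin (D.n j)) (D.K j)) :
    D.inclMatrix j y * D.inclMatrix j z = D.inclMatrix j (y * z) := by
  rw [mul_inclMatrix, equiv_inclMatrix]
  simp only [Pi.single_eq_same]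

theorem inclField_injective (i : Fin D.r) : Function.Injective (D.inclField i) := by
  intro x y h
  have := congrArg D.equiv h
  rw [equiv_inclField, equiv_inclField, Prod.ext_iff] at this
  exact Pi.single_injective i this.1

theorem inclMatrix_injective (j : Fin D.s) : Function.Injective (D.inclMatrix j) := by
  intro x y h
  have := congrArg D.equiv h
  rw [equiv_inclMatrix, equiv_inclMatrix, Prod.ext_iff] at this
  exact Pi.single_injective j this.2

theorem n_pos (j : Fin D.s) : 0 < D.n j := two_pos.trans_le (D.two_le_n j)

instance (j : Fin D.s) : NeZero (D.n j) := ⟨(D.n_pos j).ne'⟩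

theorem inclScalar_injective (j : Fin D.s) : Function.Injective (D.inclScalar j) :=
  (D.inclMatrix_injective j).comp fun _ _ h => Matrix.scalar_inj.mp h

theorem inclField_comm (i : Fin D.r) (α : D.E i) (a : A) :
    D.inclField i α * a = a * D.inclField i α := by
  rw [mul_inclField, inclField_mul, mul_comm]

theorem inclScalar_map_mul (j : Fin D.s) (α β : D.K j) :
    D.inclScalar j (α * β) = D.inclScalar j α * D.inclScalar j β := by
  simp only [inclScalar_apply, inclMatrix_mul_inclMatrix, map_mul]

theorem inclScalar_comm (j : Fin D.s) (α : D.K j) (a : A) :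
    D.inclScalar j α * a = a * D.inclScalar j α := by
  simp only [inclScalar_apply]
  rw [mul_inclMatrix, inclMatrix_mul, (Matrix.scalar_commute α (Commute.all α) _).eq]

theorem inclScalar_one_mul (j : Fin D.s) {m : A} (hm : m ∈ D.component j) :
    D.inclScalar j 1 * m = m := by
  obtain ⟨h1, h2⟩ := hm
  apply D.equiv.injective
  rw [inclScalar_apply, inclMatrix_mul, map_one, one_mul, equiv_inclMatrix, Prod.ext_iff]
  refine ⟨h1.symm, funext fun l => ?_⟩
  rcases eq_or_ne l j with rfl | hl
  · exact Pi.single_eq_same _ _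
  · rw [h2 l hl]
    exact Pi.single_eq_of_ne hl _

/-- For `d ≠ a`, `e_ad = e_ad e_dd` while `e_dd e_ad = 0`, so a commutative target kills `e_ad`, and
with it `e_ab = e_ad e_db`. -/
theorem map_inclMatrix_eq_zero {C : Type x} [CommRing C] [Algebra F C] (f : A →ₐ[F] C)
    (j : Fin D.s) (y : Matrix (Fin (D.n j)) (Fin (D.n j)) (D.K j)) : f (D.inclMatrix j y) = 0 := by
  have hmul : ∀ y z, f (D.inclMatrix j (y * z)) = f (D.inclMatrix j y) * f (D.inclMatrix j z) := by
    intro y z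
    rw [← map_mul, inclMatrix_mul_inclMatrix]
  have hsingle : ∀ a b c, f (D.inclMatrix j (Matrix.single a b c)) = 0 := by
    intro a b c
    have : Nontrivial (Fin (D.n j)) := Fin.nontrivial_iff_two_le.mpr (D.two_le_n j)
    obtain ⟨d, hd⟩ := exists_ne a
    have h1 : Matrix.single a b c = Matrix.single a d (1 : D.K j) * Matrix.single d b c := by simp
    have h2 : Matrix.single a d (1 : D.K j) =
      Matrix.single a d (1 : D.K j) * Matrix.single d d (1 : D.K j) := by simp
    have h3 : Matrix.single d d (1 : D.K j) * Matrix.single a d (1 : D.K j) = 0 :=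
      Matrix.single_mul_single_of_ne _ _ _ _ hd _
    rw [h1, hmul, h2, hmul, mul_comm (f _) (f _), ← hmul, h3, map_zero, map_zero, zero_mul]
  rw [Matrix.matrix_eq_sum_single y]
  simp [hsingle]

/-- The projection of `A` to the product of the commutative components. -/
noncomputable def fieldsHom : A →ₐ[F] (∀ i, D.E i) :=
  (AlgHom.fst F _ _).comp D.equiv.toAlgHom

theorem fieldsHom_surjective : Function.Surjective D.fieldsHom := fun x =>
  ⟨D.equiv.symm (x, 0), by simp [fieldsHom]⟩

theorem eq_sum_incl (a : A) : a = D.equiv.symm ((D.equiv a).1, 0) +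
    ∑ j, D.inclMatrix j ((D.equiv a).2 j) := by
  apply D.equiv.injective
  rw [map_add, map_sum, AlgEquiv.apply_symm_apply]
  simp only [equiv_inclMatrix]
  refine Prod.ext ?_ ?_
  · simp [Prod.fst_sum]
  · simp only [Prod.snd_add, zero_add, Prod.snd_sum]
    exact (Finset.univ_sum_single _).symm

variable [Module.Finite F A]

instance finite_E (i : Fin D.r) : Module.Finite F (D.E i) :=
  Module.Finite.of_injective _ (D.inclField_injective i)

instance finite_K (j : Fin D.s) : Module.Finite F (D.K j) :=
  Module.Finite.of_injective _ (D.inclScalar_injective j)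

theorem finrank_eq : Module.finrank F A = (∑ i, Module.finrank F (D.E i)) +
    ∑ j, D.n j * D.n j * Module.finrank F (D.K j) := by
  rw [D.equiv.toLinearEquiv.finrank_eq, Module.finrank_prod, Module.finrank_pi_fintype,
    Module.finrank_pi_fintype]
  simp [Module.finrank_matrix]

/-- Below any nonzero idempotent there is one supported in a single block, of rank one if that block
is a matrix algebra; a primitive `e` must equal it. -/
theorem finrank_span_le_of_isPrimitiveIdempotent {p : ℕ} (hE : ∀ i, Module.finrank F (D.E i) ≤ p)
    (hK : ∀ j, D.n j * Module.finrank F (D.K j) ≤ p) {e : A} (he : IsPrimitiveIdempotent e) :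
    Module.finrank F (Ideal.span {e} : Ideal A) ≤ p := by
  have hee : D.equiv e * D.equiv e = D.equiv e := by rw [← map_mul, he.1.eq]
  by_cases hx : ∃ i, (D.equiv e).1 i ≠ 0
  · obtain ⟨i, hi⟩ := hx
    have hii : (D.equiv e).1 i * (D.equiv e).1 i = (D.equiv e).1 i :=
      congrFun (congrArg Prod.fst hee) i
    have hef := he.eq_of_mul_eq (f := D.inclField i ((D.equiv e).1 i))
      (by rw [IsIdempotentElem, inclField_mul_inclField, hii]) (by rw [mul_inclField, hii])
      (by rw [inclField_mul, hii]) ((map_ne_zero_iff _ (D.inclField_injective i)).mpr hi)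
    refine (finrank_span_le (D.inclField i) fun a => ?_).trans (hE i)
    rw [hef, mul_inclField]
    exact ⟨_, rfl⟩
  · have hy : ∃ j, (D.equiv e).2 j ≠ 0 := by
      by_contra h
      push Not at hx h
      exact he.2.1 ((map_eq_zero_iff _ D.equiv.injective).mp (Prod.ext (funext hx) (funext h)))
    obtain ⟨j, hj⟩ := hy
    set M := (D.equiv e).2 j with hM
    have hMM : M * M = M := congrFun (congrArg Prod.snd hee) j
    obtain ⟨a, b, hab⟩ : ∃ a b, M a b ≠ 0 := by
      by_contra h
      push Not at h
      exact hj (Matrix.ext h)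
    -- Since `M² = M`, the columns of `M` are fixed by `M` on the left and its rows on the right.
    -- The `(a, b)` entry of `M² = M` gives `φ ⬝ᵥ v = 1` after scaling by `(M a b)⁻¹`, so `v φ` is a
    -- rank-one idempotent below `M`.
    let v : Fin (D.n j) → D.K j := M.col b
    let φ : Fin (D.n j) → D.K j := (M a b)⁻¹ • M.row a
    have hv : M.mulVec v = v := by
      ext k
      exact congrFun (congrFun hMM k) b
    have hφ : Matrix.vecMul φ M = φ := by
      rw [Matrix.smul_vecMul]
      congr 1
      ext k
      exact congrFun (congrFun hMM a) k
    have hφv : φ ⬝ᵥ v = 1 := by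
      have : M.row a ⬝ᵥ v = M a b := congrFun (congrFun hMM a) b
      rw [smul_dotProduct, this, smul_eq_mul, inv_mul_cancel₀ hab]
    have hne : Matrix.vecMulVec v φ ≠ 0 := by
      intro h
      have := congrFun (congrFun h a) b
      simp only [Matrix.vecMulVec_apply, Matrix.zero_apply, v, φ, Matrix.col_apply, Pi.smul_apply,
        Matrix.row_apply, smul_eq_mul, inv_mul_cancel₀ hab, mul_one] at this
      exact hab this
    have hf : Matrix.vecMulVec v φ * Matrix.vecMulVec v φ = Matrix.vecMulVec v φ := by
      rw [Matrix.vecMulVec_mul_vecMulVec, hφv, one_smul]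
    have hef := he.eq_of_mul_eq (f := D.inclMatrix j (Matrix.vecMulVec v φ))
      (by rw [IsIdempotentElem, inclMatrix_mul_inclMatrix, hf])
      (by rw [mul_inclMatrix, ← hM, Matrix.mul_vecMulVec, hv])
      (by rw [inclMatrix_mul, ← hM, Matrix.vecMulVec_mul, hφ])
      ((map_ne_zero_iff _ (D.inclMatrix_injective j)).mpr hne)
    -- Left multiples of `v φ` have the form `u φ`, so the column `u` parametrizes the ideal.
    let Φ : (Fin (D.n j) → D.K j) →ₗ[F] A := D.inclMatrix j ∘ₗ
      { toFun := fun u => Matrix.vecMulVec u φ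
        map_add' := fun u u' => Matrix.add_vecMulVec _ _ _
        map_smul' := fun c u => Matrix.smul_vecMulVec _ _ _ }
    refine (finrank_span_le Φ fun a => ?_).trans ?_
    · rw [hef, mul_inclMatrix, Matrix.mul_vecMulVec]
      exact ⟨_, rfl⟩
    · rw [Module.finrank_pi_fintype]
      simpa using hK j

end Basic

end WedderburnDecomposition

/-! ### Existence of the decomposition -/

section Existence

/-- Wedderburn's little theorem; finiteness also allows the field to be moved to any universe. -/
theorem exists_field_algEquiv (F : Type u) [Field F] (D : Type v) [DivisionRing D] [Algebra F D]
    [Finite D] : ∃ (L : Type w) (_ : Field L) (_ : Algebra F L), Nonempty (D ≃ₐ[F] L) := by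
  have : Small.{w} D := Countable.toSmall D
  let _ : Field (Shrink.{w} D) :=
    { (equivShrink D).symm.divisionRing with
      mul_comm := fun a b => (equivShrink D).symm.injective (by
        change (equivShrink D).symm (equivShrink D _) = (equivShrink D).symm (equivShrink D _)
        rw [(littleWedderburn D).mul_comm]) }
  exact ⟨Shrink.{w} D, inferInstance, (equivShrink D).symm.algebra F,
    ⟨((equivShrink D).symm.algEquiv F).symm⟩⟩

/-- A product of algebras splits as the product over the indices satisfying a predicate
and the product over the others. -/
noncomputable def piAlgEquivSubtypeProd (F : Type u) [CommSemiring F] {I : Type v} (P : I → Prop)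
    (M : I → Type w) [∀ i, Semiring (M i)] [∀ i, Algebra F (M i)] :
    (∀ i, M i) ≃ₐ[F] (∀ i : {i // P i}, M i) × (∀ i : {i // ¬ P i}, M i) :=
  AlgEquiv.ofBijective
    ((AlgHom.pi fun i : {i // P i} => Pi.evalAlgHom F M i).prod
      (AlgHom.pi fun i : {i // ¬ P i} => Pi.evalAlgHom F M i))
    (by classical exact (Equiv.piEquivPiSubtypeProd P M).bijective)

/-- A product of algebras of matrices of size one is the product of the coefficient rings. -/
noncomputable def piMatrixAlgEquiv (F : Type u) [CommSemiring F] {I : Type v} (n : I → ℕ)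
    (hn : ∀ i, n i = 1) (L : I → Type w) [∀ i, Semiring (L i)] [∀ i, Algebra F (L i)] :
    (∀ i, Matrix (Fin (n i)) (Fin (n i)) (L i)) ≃ₐ[F] ∀ i, L i :=
  AlgEquiv.piCongrRight fun i =>
    (Matrix.reindexAlgEquiv F (L i) ((finCongr (hn i)).trans finOneEquiv)).trans
      Matrix.uniqueAlgEquiv

theorem nonempty_wedderburnDecomposition (F : Type u) [Field F] (A : Type v) [Ring A]
    [Algebra F A] [Finite A] [IsSemisimpleRing A] :
    Nonempty (WedderburnDecomposition.{u, v, w} F A) := by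
  obtain ⟨m, D, d, _, _, hd, ⟨g⟩⟩ :=
    IsSemisimpleRing.exists_algEquiv_pi_matrix_divisionRing F A
  have hfin : ∀ i, Finite (D i) := fun i => by
    -- One matrix entry already maps the finite ring `A` onto `D i`.
    have hsurj : Function.Surjective fun a => g a i 0 0 := fun c =>
      ⟨g.symm (Pi.single i (Matrix.of fun _ _ => c)), by
        simp only [AlgEquiv.apply_symm_apply, Pi.single_eq_same, Matrix.of_apply]⟩
    exact Finite.of_surjective _ hsurj
  choose L hL hLA hLe using fun i => exists_field_algEquiv.{u, v, w} F (D i)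
  have g' : A ≃ₐ[F] ∀ i, Matrix (Fin (d i)) (Fin (d i)) (L i) :=
    g.trans (AlgEquiv.piCongrRight fun i => (hLe i).some.mapMatrix)
  let P : Fin m → Prop := fun i => d i = 1
  let e₁ := Finite.equivFin {i // P i}
  let e₂ := Finite.equivFin {i // ¬ P i}
  have u₁ : (∀ i : {i // P i}, Matrix (Fin (d i)) (Fin (d i)) (L i)) ≃ₐ[F]
      ∀ k, L (e₁.symm k) :=
    (piMatrixAlgEquiv F (fun i : {i // P i} => d i) (fun i => i.2) fun i => L i).trans
      (AlgEquiv.piCongrLeft F (fun i : {i // P i} => L i) e₁.symm).symm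
  have u₂ : (∀ i : {i // ¬ P i}, Matrix (Fin (d i)) (Fin (d i)) (L i)) ≃ₐ[F]
      ∀ k, Matrix (Fin (d (e₂.symm k))) (Fin (d (e₂.symm k))) (L (e₂.symm k)) :=
    (AlgEquiv.piCongrLeft F
      (fun i : {i // ¬ P i} => Matrix (Fin (d i)) (Fin (d i)) (L i)) e₂.symm).symm
  exact ⟨{
    r := _
    s := _
    E := fun k => L (e₁.symm k)
    K := fun k => L (e₂.symm k)
    n := fun k => d (e₂.symm k)
    two_le_n := fun k => by
      have h1 : d (e₂.symm k) ≠ 1 := (e₂.symm k).2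
      have h2 := (hd (e₂.symm k)).out
      omega
    equiv := g'.trans ((piAlgEquivSubtypeProd F P _).trans (u₁.prodCongr u₂)) }⟩

end Existence

/-! ### The dimension count for group algebras -/

namespace WedderburnDecomposition

variable {F : Type u} [Field F] {H : Type v} [Group H]

theorem s_pos (D : WedderburnDecomposition.{u, max u v, w} F (MonoidAlgebra F H))
    (hH : ∃ a b : H, a * b ≠ b * a) : 0 < D.s := by
  by_contra hs
  have : IsEmpty (Fin D.s) := ⟨fun j => hs j.pos⟩
  obtain ⟨a, b, hab⟩ := hH
  apply hab
  apply MonoidAlgebra.of_injective (R := F)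
  apply D.equiv.injective
  simp only [map_mul, Prod.ext_iff]
  exact ⟨mul_comm _ _, Subsingleton.elim _ _⟩

/-- There are linear surjections both ways between `F[H / H']` and `∏ E_i`; the one out of `∏ E_i`
is onto because the matrix blocks vanish in `F[H / H']`. -/
theorem sum_finrank_fields [Finite H]
    (D : WedderburnDecomposition.{u, max u v, w} F (MonoidAlgebra F H)) :
    ∑ i, Module.finrank F (D.E i) = Nat.card (Abelianization H) := by
  rw [← Module.finrank_pi_fintype, ← finrank_monoidAlgebra F (Abelianization H)]
  apply le_antisymm
  · exact LinearMap.finrank_le_finrank_of_surjective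
      (f := (liftAbelianization D.fieldsHom).toLinearMap)
      (liftAbelianization_surjective D.fieldsHom_surjective)
  · refine LinearMap.finrank_le_finrank_of_surjective
      (f := (abelianizationAlgHom F H).toLinearMap ∘ₗ D.equiv.symm.toLinearMap ∘ₗ
        LinearMap.inl F (∀ i, D.E i) _) fun y => ?_
    obtain ⟨a, rfl⟩ := abelianizationAlgHom_surjective F H y
    refine ⟨(D.equiv a).1, ?_⟩
    conv_rhs => rw [D.eq_sum_incl a, map_add, map_sum]
    simp only [map_inclMatrix_eq_zero, Finset.sum_const_zero, add_zero]
    rfl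

variable [Finite H] (D : WedderburnDecomposition.{u, max u v, w} F (MonoidAlgebra F H))

theorem sum_finrank_matrices :
    ∑ j, D.n j * D.n j * Module.finrank F (D.K j) = gam H := by
  have h := D.finrank_eq
  rw [finrank_monoidAlgebra, sum_finrank_fields] at h
  rw [gam, h, Nat.add_sub_cancel_left]

theorem mul_finrank_le_gam (j : Fin D.s) :
    D.n j * D.n j * Module.finrank F (D.K j) ≤ gam H := by
  rw [← D.sum_finrank_matrices]
  exact Finset.single_le_sum (f := fun j => D.n j * D.n j * Module.finrank F (D.K j))
    (fun _ _ => Nat.zero_le _) (Finset.mem_univ j)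

theorem maxDim_le : D.maxDim ≤ bZero (gam H) :=
  Finset.sup_le fun j _ => mul_le_bZero (D.two_le_n j) (D.mul_finrank_le_gam j)

theorem isMinimalECD [IsSemisimpleRing (MonoidAlgebra F H)] {p : ℕ} [CharP F p]
    (hE : ∀ i, Module.finrank F (D.E i) ≤ p)
    (hK : ∀ j, D.n j * Module.finrank F (D.K j) ≤ p) : IsMinimalECD F H := by
  refine ⟨inferInstance, fun e he => ⟨⟨e, he.1, rfl⟩, ?_⟩⟩
  rw [ringChar.eq F p]
  exact D.finrank_span_le_of_isPrimitiveIdempotent hE hK he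

theorem finrank_field_le [Finite F] {t : ℕ} (ht : 0 < t)
    (h : ∀ g : Abelianization H, g ^ (Nat.card F ^ t) = g) (i : Fin D.r) :
    Module.finrank F (D.E i) ≤ t := by
  refine finrank_le_of_pow_eq (χ := (Pi.evalAlgHom F D.E i).comp D.fieldsHom) ?_ ht h
  rw [AlgHom.coe_comp]
  exact (Function.surjective_eval i).comp D.fieldsHom_surjective

theorem maxSize_bounds (hs : 0 < D.s) (hK : ∀ j, Module.finrank F (D.K j) = 1) :
    ⌈Real.sqrt ((gam H : ℝ) / (D.s : ℝ))⌉₊ ≤ D.maxSize ∧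
      D.maxSize ≤ ⌊Real.sqrt (gam H : ℝ)⌋₊ := by
  constructor
  · refine ceil_sqrt_div_le hs ?_
    rw [← D.sum_finrank_matrices]
    refine (Finset.sum_le_card_nsmul _ _ (D.maxSize * D.maxSize) fun j _ => ?_).trans (by simp)
    rw [hK, mul_one]
    exact Nat.mul_self_le_mul_self (Finset.le_sup (Finset.mem_univ j))
  · refine Finset.sup_le fun j _ => le_floor_sqrt ?_
    simpa [hK] using D.mul_finrank_le_gam j

end WedderburnDecomposition

end GroupCode

/-! ### The main theorem -/

theorem mainTheorem9 {F : Type u} [Field F] [Finite F] {H : Type v} [Group H] [Finite H]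
    (p q : ℕ) [CharP F p] (hq : Nat.card F = q)
    (hp : ¬ p ∣ Nat.card H) (hH : ∃ a b : H, a * b ≠ b * a)
    (w : Abelianization H) (hw : orderOf w = Monoid.exponent (Abelianization H)) :
    -- the Wedderburn decomposition exists
    Nonempty (GroupCode.WedderburnDecomposition.{u, max u v, x} F (MonoidAlgebra F H)) ∧
    -- part 1
    (∀ D : GroupCode.WedderburnDecomposition.{u, max u v, x} F (MonoidAlgebra F H),
      0 < D.s ∧ D.maxDim ≤ GroupCode.bZero (GroupCode.gam H)) ∧
    GroupCode.bZero (GroupCode.gam H) ≤ GroupCode.gam H / 2 ∧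
    -- part 2
    (GroupCode.qOrbitSize q w ≤ p →
      (GroupCode.bZero (GroupCode.gam H) ≤ p ∨ GroupCode.gam H / 2 ≤ p) →
      GroupCode.IsMinimalECD F H) ∧
    -- part 3
    (∀ D : GroupCode.WedderburnDecomposition.{u, max u v, x} F (MonoidAlgebra F H),
      (∀ j, ∃ I : Ideal (MonoidAlgebra F H), IsAtom I ∧ I ≤ D.component j ∧
        GroupCode.IsAbsolutelySimple F (MonoidAlgebra F H) I) →
      ⌈Real.sqrt ((GroupCode.gam H : ℝ) / (D.s : ℝ))⌉₊ ≤ D.maxSize ∧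
      D.maxSize ≤ ⌊Real.sqrt (GroupCode.gam H : ℝ)⌋₊ ∧
      (⌊Real.sqrt (GroupCode.gam H : ℝ)⌋₊ ≤ p → GroupCode.qOrbitSize q w ≤ p →
        GroupCode.IsMinimalECD F H)) ∧
    (GroupCode.IsSplittingFieldFor F H → ⌊Real.sqrt (GroupCode.gam H : ℝ)⌋₊ ≤ p →
      GroupCode.IsMinimalECD F H) := by
  classical
  have hpp : p.Prime := (CharP.char_is_prime_or_zero F p).resolve_right
    (CharP.char_ne_zero_of_finite F p)
  -- Maschke's condition, from which semisimplicity follows.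
  have : NeZero (Nat.card H : F) := ⟨fun h => hp ((CharP.cast_eq_zero_iff F p _).mp h)⟩
  have hss : IsSemisimpleRing (MonoidAlgebra F H) := inferInstance
  have : Finite (MonoidAlgebra F H) := Module.finite_of_finite F
  have hcop : q.Coprime (Nat.card (Abelianization H)) := by
    have : Fintype F := Fintype.ofFinite F
    obtain ⟨k, -, hk⟩ := FiniteField.card F p
    rw [← hq, Nat.card_eq_fintype_card, hk]
    exact Nat.Coprime.pow_left _ ((Nat.Prime.coprime_iff_not_dvd hpp).mpr fun h =>
      hp (h.trans (Subgroup.card_quotient_dvd_card _)))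
  obtain ⟨ht0, ht⟩ := GroupCode.qOrbitSize_spec hcop w
  have htall := GroupCode.pow_eq_self_of_orderOf_eq_exponent hw ht
  rw [← hq] at ht0 htall
  have hE : ∀ D : GroupCode.WedderburnDecomposition.{u, max u v, x} F (MonoidAlgebra F H),
      GroupCode.qOrbitSize q w ≤ p → ∀ i, Module.finrank F (D.E i) ≤ p := fun D h i =>
    (D.finrank_field_le ht0 htall i).trans (hq ▸ h)
  have hhalf := GroupCode.bZero_le_half (GroupCode.gam H)
  obtain ⟨D₀⟩ := GroupCode.nonempty_wedderburnDecomposition.{u, max u v, x} F (MonoidAlgebra F H)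
  refine ⟨⟨D₀⟩, fun D => ⟨D.s_pos hH, D.maxDim_le⟩, hhalf, fun htp hb => ?_, fun D hD => ?_,
    fun hspl hsq => ?_⟩
  · have hbp : GroupCode.bZero (GroupCode.gam H) ≤ p := hb.elim id hhalf.trans
    exact D₀.isMinimalECD (hE D₀ htp) fun j =>
      ((Finset.le_sup (f := fun j => D₀.n j * Module.finrank F (D₀.K j))
        (Finset.mem_univ j)).trans D₀.maxDim_le).trans hbp
  · have hK : ∀ j, Module.finrank F (D.K j) = 1 := fun j => by
      obtain ⟨I, -, hle, habs⟩ := hD j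
      exact GroupCode.finrank_eq_one_of_surjective
        (GroupCode.algebraMap_surjective_of_isAbsolutelySimple (D.inclScalar_map_mul j)
          (D.inclScalar_comm j) I (fun m hm => D.inclScalar_one_mul j (hle hm)) habs)
    obtain ⟨h1, h2⟩ := D.maxSize_bounds (D.s_pos hH) hK
    refine ⟨h1, h2, fun hsq htp => D.isMinimalECD (hE D htp) fun j => ?_⟩
    rw [hK, mul_one]
    exact ((Finset.le_sup (Finset.mem_univ j)).trans h2).trans hsq
  · have hK : ∀ j, Module.finrank F (D₀.K j) = 1 := fun j =>
      GroupCode.finrank_eq_one_of_surjective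
        (GroupCode.algebraMap_surjective_of_isSplittingFieldFor (D₀.inclScalar_map_mul j)
          (D₀.inclScalar_comm j)
          ((map_ne_zero_iff _ (D₀.inclScalar_injective j)).mpr one_ne_zero) hspl)
    -- Splitting also makes every `E_i` equal to `F`, so no bound on `t_w` is needed here.
    have hE1 : ∀ i, Module.finrank F (D₀.E i) = 1 := fun i =>
      GroupCode.finrank_eq_one_of_surjective
        (GroupCode.algebraMap_surjective_of_isSplittingFieldFor
          (fun α β => (D₀.inclField_mul_inclField i α β).symm) (D₀.inclField_comm i)
          ((map_ne_zero_iff _ (D₀.inclField_injective i)).mpr one_ne_zero) hspl)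
    refine D₀.isMinimalECD (fun i => (hE1 i).trans_le hpp.one_le) fun j => ?_
    rw [hK, mul_one]
    exact ((Finset.le_sup (Finset.mem_univ j)).trans (D₀.maxSize_bounds (D₀.s_pos hH) hK).2).trans
      hsq
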